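/- Let $d\ge 1$, $L>0$, let $\Omega=(\mathbb R/L\mathbb Z)^d$ be the $d$-dimensional torus of side length $L$, and let $\mathcal P(\Omega)$ be the set of Borel probability measures on $\Omega$. Let $W\in C^2(\Omega)$ be even along every coordinate with $\int_\Omega W\,dx=0$, and let $m\in(1,\infty)$. Write $(W\star\rho)(x)=\int_\Omega W(x-y)\rho(y)\,dy$. For $\beta>0$ the free energy $\mathcal F_\beta^m:\mathcal P(\Omega)\to(-\infty,+\infty]$ is $$\mathcal F_\beta^m(\rho)=\frac{\beta^{-1}}{m-1}\int_\Omega\rho(x)^m\,dx-\frac{\beta^{-1}}{m-1}+\frac12\iint_{\Omega\times\Omega}W(x-y)\rho(x)\rho(y)\,dx\,dy$$ if the measure is absolutely continuous with density $\rho\in L^m(\Omega)$, and $+\infty$ otherwise. A measure in $\mathcal P(\Omega)$ is a stationary solution of $$\partial_t\rho=\beta^{-1}\Delta\rho^m+\nabla\cdot(\rho\nabla W\star\rho)$$ if it has a density $\rho\in L^2(\Omega)\cap L^m(\Omega)$ with $\rho^m\in H^1(\Omega)$ (the periodic Sobolev space) and $$\int_\Omega\left(\beta^{-1}\nabla\rho^m+\rho\,\nabla(W\star\rho)\right)\cdot\nabla\varphi\,dx=0\qquad\text{for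 all }\varphi\in H^1(\Omega).$$ Then there exists $\delta>0$ (which may depend on $d$, $L$, $W$ and $m$) such that for every $\beta\in(0,\delta)$ the flat state $\rho_\infty\equiv L^{-d}$ is the unique stationary solution in $\mathcal P(\Omega)$, and it is also the unique minimiser of $\mathcal F_\beta^m$ over $\mathcal P(\Omega)$. -/

import Mathlib

open MeasureTheory
open scoped ContDiff

namespace AggDiff

/-- The `d`-dimensional torus `(ℝ / L ℤ)^d` of side length `L`. Its measure `volume` is the
product of the Lebesgue measures on the circles, so the total mass is `L ^ d`. -/
abbrev Torus (d : ℕ) (L : ℝ) : Type := Fin d → AddCircle L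

/-- The quotient map `ℝ^d → (ℝ / L ℤ)^d`. -/
def toTorus {d : ℕ} {L : ℝ} (y : Fin d → ℝ) : Torus d L := fun i => (y i : AddCircle L)

/-- `f ∈ C^n(Ω)`: the periodic lift of `f` to `ℝ^d` is of class `C^n`. -/
def IsCk {d : ℕ} {L : ℝ} (n : ℕ∞) (f : Torus d L → ℝ) : Prop :=
  ContDiff ℝ n (fun y : Fin d → ℝ => f (toTorus y))

/-- `f` is even along every coordinate. -/
def EvenInEachCoordinate {d : ℕ} {L : ℝ} (f : Torus d L → ℝ) : Prop :=
  ∀ (i : Fin d) (x : Torus d L), f (Function.update x i (-(x i))) = f x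

/-- The classical partial derivative `∂ᵢ f (x)` on the torus. -/
noncomputable def partialDeriv {d : ℕ} {L : ℝ} (i : Fin d) (f : Torus d L → ℝ)
    (x : Torus d L) : ℝ :=
  deriv (fun t : ℝ => f (x + Pi.single i (t : AddCircle L))) 0

section

variable {d : ℕ} {L : ℝ} [Fact (0 < L)]

/-- `f` belongs to the periodic Sobolev space `H¹(Ω)` and `g = (g₁, …, g_d)` is its weak
gradient: `f, gᵢ ∈ L²(Ω)` and `∫ f ∂ᵢφ = - ∫ gᵢ φ` for all `φ ∈ C^∞(Ω)`. -/
structure HasH1Gradient (f : Torus d L → ℝ) (g : Fin d → Torus d L → ℝ) : Prop where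
  memLp : MemLp f 2 volume
  memLp_grad : ∀ i, MemLp (g i) 2 volume
  integral_eq : ∀ i, ∀ φ : Torus d L → ℝ, IsCk (⊤ : ℕ∞) φ →
    ∫ x, f x * partialDeriv i φ x = - ∫ x, g i x * φ x

/-- The convolution `(W ⋆ ρ)(x) = ∫ W(x - y) ρ(y) dy` over the torus. -/
noncomputable def conv (W ρ : Torus d L → ℝ) (x : Torus d L) : ℝ :=
  ∫ y, W (x - y) * ρ y

/-- The Lebesgue density of a probability measure on the torus (meaningful if the measure is
absolutely continuous). -/
noncomputable def density (μ : ProbabilityMeasure (Torus d L)) (x : Torus d L) : ℝ :=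
  ((μ : Measure (Torus d L)).rnDeriv volume x).toReal

/-- The entropy `S_β^m(ρ) = β⁻¹ / (m - 1) ∫ ρ^m - β⁻¹ / (m - 1)`. -/
noncomputable def entropy (β m : ℝ) (ρ : Torus d L → ℝ) : ℝ :=
  β⁻¹ / (m - 1) * (∫ x, ρ x ^ m) - β⁻¹ / (m - 1)

/-- The interaction energy `½ ∬ W(x - y) ρ(x) ρ(y) dx dy`. -/
noncomputable def interactionEnergy (W ρ : Torus d L → ℝ) : ℝ :=
  1 / 2 * ∫ x, ∫ y, W (x - y) * ρ x * ρ y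

open Classical in
/-- The free energy `F_β^m` (for `m > 1`) on all Borel probability measures: `+∞` unless the
measure has a density in `L^m(Ω)`. -/
noncomputable def freeEnergy (β m : ℝ) (W : Torus d L → ℝ)
    (μ : ProbabilityMeasure (Torus d L)) : EReal :=
  if (μ : Measure (Torus d L)) ≪ volume ∧ MemLp (density μ) (ENNReal.ofReal m) volume then
    ((entropy β m (density μ) + interactionEnergy W (density μ) : ℝ) : EReal)
  else ⊤

/-- `μ` is a minimiser of `F_β^m` over all Borel probability measures. -/
def IsFreeEnergyMinimiser (β m : ℝ) (W : Torus d L → ℝ)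
    (μ : ProbabilityMeasure (Torus d L)) : Prop :=
  ∀ ν : ProbabilityMeasure (Torus d L), freeEnergy β m W μ ≤ freeEnergy β m W ν

/-- `μ = ρ dx` is a stationary solution, i.e. a weak solution of
`β⁻¹ Δ ρ^m + ∇ · (ρ ∇ (W ⋆ ρ)) = 0`: the density `ρ` lies in `L²(Ω) ∩ L^m(Ω)`,
`ρ^m ∈ H¹(Ω)`, and `∫ (β⁻¹ ∇ρ^m + ρ ∇(W ⋆ ρ)) · ∇φ = 0` for every `φ ∈ H¹(Ω)`.
The weak gradient `g` of `ρ^m` is unique up to null sets, so its choice is immaterial. -/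
structure IsStationarySolution (β m : ℝ) (W : Torus d L → ℝ)
    (μ : ProbabilityMeasure (Torus d L)) : Prop where
  absolutelyContinuous : (μ : Measure (Torus d L)) ≪ volume
  memLp_two : MemLp (density μ) 2 volume
  memLp : MemLp (density μ) (ENNReal.ofReal m) volume
  weak_form : ∃ g : Fin d → Torus d L → ℝ,
    HasH1Gradient (fun x => density μ x ^ m) g ∧
    ∀ (φ : Torus d L → ℝ) (ψ : Fin d → Torus d L → ℝ), HasH1Gradient φ ψ →
      ∫ x, ∑ i, (β⁻¹ * g i x + density μ x * partialDeriv i (conv W (density μ)) x) * ψ i x = 0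

variable (d L) in
/-- The flat state `ρ_∞ = L^{-d}`, as a probability measure. -/
noncomputable def flatState : ProbabilityMeasure (Torus d L) :=
  ⟨(volume : Measure (Torus d L)).withDensity (fun _ => ENNReal.ofReal ((L ^ d)⁻¹)), ⟨by
    have hL : (0 : ℝ) < L := Fact.out
    have hpow : (0 : ℝ) < L ^ d := pow_pos hL d
    have hv : (volume : Measure (Torus d L)) Set.univ = ENNReal.ofReal (L ^ d) := by
      rw [← Set.pi_univ Set.univ, volume_pi_pi]
      simp [AddCircle.measure_univ, ENNReal.ofReal_pow hL.le]
    rw [withDensity_apply _ MeasurableSet.univ, setLIntegral_const, hv,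
      ← ENNReal.ofReal_mul (by positivity), inv_mul_cancel₀ hpow.ne', ENNReal.ofReal_one]⟩⟩

end

end AggDiff

/-! Everything is measured by N = ‖ρ - a‖₁, where a = L^{-d}. Because W has mean zero, W ⋆ ρ and the
interaction energy do not change when ρ is replaced by ρ - a. Hence ∇(W ⋆ ρ) is O(N) and the
interaction energy is O(N²), with constants depending only on W.

Minimisers: a Pinsker-type inequality (`le_integral_density_rpow`) bounds the entropy gap to the
flat state below by β⁻¹ a^{m-1} N² / 4. For small β this beats the interaction, so any competitor
with energy at most that of the flat state has N = 0. Existence comes for free, without compactness.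

Stationary states: testing the equation with ρ^m gives ‖∇ρ^m‖₂² ≤ β² d (KN)² ∫ρ², with K a Lipschitz
constant of W along the coordinates. Poincaré's inequality (`poincare`) turns this into a bound on
the variance of ρ^m, which dominates a^{2(m-1)} X with X = ∫ρ² - a (`integral_density_sq_sub_le`).
Since N² ≤ X / a and N ≤ 2, also N² ∫ρ² = N² X + N² a ≤ 5X. Thus X is at most a multiple O(β²) of
itself, and vanishes for small β. No a priori bound on ρ is needed. -/

namespace AggDiff

/-! ### Calculus on the torus: lifts, partial derivatives, weak gradients. -/

section Basics

variable {d : ℕ} {L : ℝ}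

theorem isOpenQuotientMap_toTorus : IsOpenQuotientMap (toTorus : (Fin d → ℝ) → Torus d L) :=
  IsOpenQuotientMap.piMap fun _ => QuotientAddGroup.isOpenQuotientMap_mk

theorem toTorus_add_single (y : Fin d → ℝ) (i : Fin d) (t : ℝ) :
    (toTorus y + Pi.single i (t : AddCircle L) : Torus d L) = toTorus (y + Pi.single i t) := by
  funext j
  by_cases h : j = i
  · subst h; simp [toTorus]
  · simp [toTorus, h]

theorem IsCk.continuous {n : ℕ∞} {f : Torus d L → ℝ} (hf : IsCk n f) : Continuous f :=
  isOpenQuotientMap_toTorus.isQuotientMap.continuous_iff.2 (ContDiff.continuous hf)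

theorem IsCk.mono {m n : ℕ∞} {f : Torus d L → ℝ} (hf : IsCk n f) (h : m ≤ n) : IsCk m f :=
  ContDiff.of_le hf (by exact_mod_cast h)

theorem IsCk.hasDerivAt_partialDeriv {f : Torus d L → ℝ} (hf : IsCk 1 f) (i : Fin d)
    (x : Torus d L) :
    HasDerivAt (fun t : ℝ => f (x + Pi.single i (t : AddCircle L))) (partialDeriv i f x) 0 := by
  obtain ⟨y, rfl⟩ := isOpenQuotientMap_toTorus.surjective x
  apply DifferentiableAt.hasDerivAt
  simp only [toTorus_add_single]
  have h1 : Differentiable ℝ (fun y : Fin d → ℝ => f (toTorus y)) :=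
    ContDiff.differentiable hf (by norm_num)
  have h2 : Differentiable ℝ (fun t : ℝ => y + Pi.single i t) := by
    rw [differentiable_pi]
    intro j
    by_cases h : j = i
    · subst h; simpa using differentiable_id.const_add (y j)
    · simp [h]
  exact (h1.comp h2) 0

theorem continuous_coe_single (i : Fin d) :
    Continuous (fun t : ℝ => (Pi.single i (t : AddCircle L) : Torus d L)) :=
  (continuous_single i).comp continuous_quotient_mk'

/-- Continuity suffices, since `deriv` is 0 where the derivative fails to exist. This allows f = W ⋆
ρ without first proving it differentiable. -/
theorem measurable_partialDeriv {f : Torus d L → ℝ} (hf : Continuous f) (i : Fin d) :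
    Measurable (partialDeriv i f) := by
  have h : Continuous (Function.uncurry
      fun (x : Torus d L) (t : ℝ) => f (x + Pi.single i (t : AddCircle L))) :=
    hf.comp (continuous_fst.add ((continuous_coe_single i).comp continuous_snd))
  exact (measurable_deriv_with_param h).comp (measurable_id.prodMk measurable_const)

variable [Fact (0 < L)]

theorem exists_toTorus_eq (x : Torus d L) :
    ∃ y : Fin d → ℝ, (∀ i, y i ∈ Set.Icc 0 L) ∧ toTorus y = x := by
  have h : ∀ i, ∃ z ∈ Set.Icc (0 : ℝ) L, (z : AddCircle L) = x i := fun i => by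
    have := AddCircle.coe_image_Icc_eq L 0
    rw [zero_add] at this
    simpa using this.ge (Set.mem_univ (x i))
  choose y hy hyx using h
  exact ⟨y, hy, funext hyx⟩

/-- A `C^1` function on the torus is uniformly Lipschitz along short coordinate segments. -/
theorem IsCk.exists_lipschitz {f : Torus d L → ℝ} (hf : IsCk 1 f) :
    ∃ K : ℝ, 0 ≤ K ∧ ∀ (i : Fin d) (x : Torus d L), ∀ s ∈ Set.Icc (-1 : ℝ) 1,
      ∀ t ∈ Set.Icc (-1 : ℝ) 1,
      |f (x + Pi.single i (t : AddCircle L)) - f (x + Pi.single i (s : AddCircle L))|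
        ≤ K * |t - s| := by
  -- A fundamental cell [0, L]^d enlarged by 1, so that it contains every segment used; being
  -- compact and convex, it permits the mean value inequality.
  set B : Set (Fin d → ℝ) := Set.Icc (fun _ => -1) (fun _ => L + 1)
  set F : (Fin d → ℝ) → ℝ := fun y => f (toTorus y)
  have hF : ContDiff ℝ 1 F := hf
  obtain ⟨K, hK⟩ := (isCompact_Icc : IsCompact B).exists_bound_of_continuousOn
    (hF.continuous_fderiv (by norm_num)).continuousOn
  refine ⟨max K 0, le_max_right _ _, fun i x s hs t ht => ?_⟩
  obtain ⟨y, hy, rfl⟩ := exists_toTorus_eq x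
  have hmem : ∀ r ∈ Set.Icc (-1 : ℝ) 1, y + Pi.single i r ∈ B := by
    intro r hr
    constructor <;> intro j <;> have := hy j <;> rw [Set.mem_Icc] at this hr <;>
      by_cases h : j = i
    · subst h; simp; linarith
    · simp [h]; linarith
    · subst h; simp; linarith
    · simp [h]; linarith
  have := (convex_Icc _ _ : Convex ℝ B).norm_image_sub_le_of_norm_fderiv_le (𝕜 := ℝ) (f := F)
    (fun z _ => (hF.differentiable (by norm_num)) z)
    (fun z hz => (hK z hz).trans (le_max_left K 0)) (hmem s hs) (hmem t ht)
  rw [toTorus_add_single, toTorus_add_single]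
  have e : y + Pi.single i t - (y + Pi.single i s) = Pi.single i (t - s) := by
    rw [add_sub_add_left_eq_sub, ← Pi.single_sub]
  rwa [e, Pi.norm_single, Real.norm_eq_abs, Real.norm_eq_abs] at this

instance : (volume : Measure (Torus d L)).IsNegInvariant :=
  Measure.IsAddHaarMeasure.isNegInvariant_of_regular _

theorem volume_real_univ : (volume : Measure (Torus d L)).real Set.univ = L ^ d := by
  have hL : (0 : ℝ) < L := Fact.out
  rw [measureReal_def, ← Set.pi_univ Set.univ, volume_pi_pi]
  simp [AddCircle.measure_univ, hL.le]

theorem integrable_of_continuous {f : Torus d L → ℝ} (hf : Continuous f) :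
    Integrable f volume :=
  hf.integrable_of_hasCompactSupport (HasCompactSupport.of_compactSpace f)

/-- By translation invariance ∫ f(x + t eᵢ) dx does not depend on t; differentiate under the
integral at t = 0. -/
theorem IsCk.integral_partialDeriv_eq_zero {f : Torus d L → ℝ} (hf : IsCk 1 f) (i : Fin d) :
    ∫ x, partialDeriv i f x = 0 := by
  obtain ⟨K, hK0, hK⟩ := hf.exists_lipschitz
  have hc : ∀ t : ℝ, Continuous fun x : Torus d L => f (x + Pi.single i (t : AddCircle L)) :=
    fun t => hf.continuous.comp (continuous_add_const _)
  have h := (hasDerivAt_integral_of_dominated_loc_of_lip (μ := (volume : Measure (Torus d L)))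
    (F := fun (t : ℝ) x => f (x + Pi.single i (t : AddCircle L))) (F' := partialDeriv i f)
    (x₀ := 0) (s := Set.Icc (-1) 1) (bound := fun _ => K)
    (Icc_mem_nhds (by norm_num) (by norm_num))
    (Filter.Eventually.of_forall fun t => (hc t).aestronglyMeasurable)
    (integrable_of_continuous (hc 0))
    (measurable_partialDeriv hf.continuous i).aestronglyMeasurable
    (Filter.Eventually.of_forall fun x => LipschitzOnWith.of_dist_le_mul fun t ht s hs => by
      simpa [Real.dist_eq, abs_of_nonneg hK0] using hK i x s hs t ht)
    (integrable_const _)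
    (Filter.Eventually.of_forall fun x => hf.hasDerivAt_partialDeriv i x)).2
  simp only [integral_add_right_eq_self f] at h
  exact h.unique (hasDerivAt_const _ _)

theorem IsCk.exists_partialDeriv_bound {f : Torus d L → ℝ} (hf : IsCk 1 f) :
    ∃ K : ℝ, ∀ i x, |partialDeriv i f x| ≤ K := by
  obtain ⟨K, hK0, hK⟩ := hf.exists_lipschitz
  refine ⟨K, fun i x => ?_⟩
  rw [partialDeriv, ← Real.norm_eq_abs]
  refine norm_deriv_le_of_lip' hK0 ?_
  filter_upwards [Icc_mem_nhds (show (-1 : ℝ) < 0 by norm_num) one_pos] with t ht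
  simpa using hK i x 0 (by norm_num) t ht

theorem hasH1Gradient_const (c : ℝ) :
    HasH1Gradient (fun _ : Torus d L => c) (fun _ _ => 0) where
  memLp := memLp_const c
  memLp_grad _ := memLp_const 0
  integral_eq i φ hφ := by
    simp [integral_const_mul, (hφ.mono (m := 1) le_top).integral_partialDeriv_eq_zero i]

theorem HasH1Gradient.sub_const {f : Torus d L → ℝ} {g : Fin d → Torus d L → ℝ}
    (h : HasH1Gradient f g) (c : ℝ) : HasH1Gradient (fun x => f x - c) g where
  memLp := h.memLp.sub (memLp_const c)
  memLp_grad := h.memLp_grad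
  integral_eq i φ hφ := by
    have hφ1 := hφ.mono (m := 1) le_top
    obtain ⟨K, hK⟩ := hφ1.exists_partialDeriv_bound
    have hm := (measurable_partialDeriv hφ.continuous i).aestronglyMeasurable (μ := volume)
    have hb : ∀ᵐ x : Torus d L, ‖partialDeriv i φ x‖ ≤ K := Filter.Eventually.of_forall (hK i)
    have h1 : Integrable (fun x => f x * partialDeriv i φ x) volume :=
      (h.memLp.integrable one_le_two).mul_bdd hm hb
    have h2 : Integrable (partialDeriv i φ) volume := Integrable.of_bound hm K hb
    simp_rw [sub_mul]
    rw [integral_sub h1 (h2.const_mul c), integral_const_mul,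
      hφ1.integral_partialDeriv_eq_zero i, mul_zero, sub_zero, h.integral_eq i φ hφ]

end Basics

/-! ### Fourier series and Poincaré's inequality. -/

section Fourier

noncomputable local instance : MeasureSpace UnitAddCircle := ⟨AddCircle.haarAddCircle⟩

local instance : (volume : Measure UnitAddCircle).IsAddHaarMeasure :=
  inferInstanceAs AddCircle.haarAddCircle.IsAddHaarMeasure

local instance : IsProbabilityMeasure (volume : Measure UnitAddCircle) :=
  inferInstanceAs (IsProbabilityMeasure AddCircle.haarAddCircle)

variable {d : ℕ} {L : ℝ} [Fact (0 < L)]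

variable (d L) in
/-- The dilation of the torus of side length `L` onto the unit torus. -/
noncomputable def toUnit : Torus d L ≃+ UnitAddTorus (Fin d) :=
  AddEquiv.piCongrRight fun _ =>
    AddCircle.equivAddCircle L 1 (Fact.out : (0 : ℝ) < L).ne' one_ne_zero

theorem continuous_toUnit : Continuous (toUnit d L) :=
  continuous_pi fun i => (AddCircle.homeomorphAddCircle L 1 (Fact.out : (0 : ℝ) < L).ne'
    one_ne_zero).continuous.comp (continuous_apply i)

theorem continuous_toUnit_symm : Continuous (toUnit d L).symm :=
  continuous_pi fun i => (AddCircle.homeomorphAddCircle L 1 (Fact.out : (0 : ℝ) < L).ne'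
    one_ne_zero).symm.continuous.comp (continuous_apply i)

theorem toUnit_toTorus_apply (y : Fin d → ℝ) (i : Fin d) :
    toUnit d L (toTorus y) i = ((y i * (L⁻¹ * 1) : ℝ) : AddCircle (1 : ℝ)) := rfl

variable (d L) in
-- Uniqueness of Haar measure. The value of c is irrelevant: it cancels from the two sides of
-- Poincaré's inequality.
theorem exists_volume_unit_eq : ∃ c : NNReal, 0 < c ∧
    (volume : Measure (UnitAddTorus (Fin d))) =
      c • Measure.map (toUnit d L) (volume : Measure (Torus d L)) := by
  have := AddEquiv.isAddHaarMeasure_map (volume : Measure (Torus d L)) (toUnit d L)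
    continuous_toUnit continuous_toUnit_symm
  refine ⟨_, ?_, Measure.isAddInvariant_eq_smul_of_compactSpace _ _⟩
  rw [pos_iff_ne_zero]
  intro h0
  have h := Measure.isAddInvariant_eq_smul_of_compactSpace
    (volume : Measure (UnitAddTorus (Fin d)))
    (Measure.map (toUnit d L) (volume : Measure (Torus d L)))
  rw [h0, zero_smul] at h
  exact IsProbabilityMeasure.ne_zero _ h

/-- The trigonometric monomials on the torus of side length `L`. -/
noncomputable def monomial (n : Fin d → ℤ) (x : Torus d L) : ℂ :=
  UnitAddTorus.mFourier n (toUnit d L x)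

theorem continuous_monomial (n : Fin d → ℤ) : Continuous (monomial (L := L) n) :=
  (UnitAddTorus.mFourier n).continuous.comp continuous_toUnit

theorem monomial_toTorus (n : Fin d → ℤ) (y : Fin d → ℝ) :
    monomial (L := L) n (toTorus y) =
      Complex.exp (∑ i, 2 * Real.pi * Complex.I * n i * y i / L) := by
  rw [Complex.exp_sum, monomial, UnitAddTorus.mFourier, ContinuousMap.coe_mk]
  refine Finset.prod_congr rfl fun i _ => ?_
  rw [toUnit_toTorus_apply, fourier_coe_apply]
  congr 1
  push_cast
  ring

theorem monomial_add_single (n : Fin d → ℤ) (x : Torus d L) (i : Fin d) (t : ℝ) :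
    monomial n (x + Pi.single i (t : AddCircle L)) =
      monomial n x * Complex.exp ((2 * Real.pi * n i / L : ℝ) * Complex.I * t) := by
  obtain ⟨y, rfl⟩ := isOpenQuotientMap_toTorus.surjective x
  rw [toTorus_add_single, monomial_toTorus, monomial_toTorus, ← Complex.exp_add]
  congr 1
  have : ∀ j, (2 * Real.pi * Complex.I * n j * ((y + Pi.single i t : Fin d → ℝ) j : ℝ) / L : ℂ) =
      2 * Real.pi * Complex.I * n j * y j / L +
        (if i = j then 2 * Real.pi * Complex.I * n j * t / L else 0) := by
    intro j
    by_cases h : i = j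
    · subst h; simp; ring
    · simp [h, Ne.symm h]
  simp_rw [this]
  rw [Finset.sum_add_distrib, Finset.sum_ite_eq]
  simp
  ring

theorem hasDerivAt_monomial (n : Fin d → ℤ) (x : Torus d L) (i : Fin d) :
    HasDerivAt (fun t : ℝ => monomial n (x + Pi.single i (t : AddCircle L)))
      (monomial n x * ((2 * Real.pi * n i / L : ℝ) * Complex.I)) 0 := by
  simp_rw [monomial_add_single]
  have h : HasDerivAt (fun t : ℝ => ((2 * Real.pi * n i / L : ℝ) * Complex.I * t : ℂ))
      ((2 * Real.pi * n i / L : ℝ) * Complex.I) 0 := by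
    simpa using (Complex.ofRealCLM.hasDerivAt (x := 0)).const_mul
      ((2 * Real.pi * n i / L : ℝ) * Complex.I : ℂ)
  simpa using h.cexp.const_mul (monomial n x)

theorem contDiff_monomial (n : Fin d → ℤ) :
    ContDiff ℝ ((⊤ : ℕ∞) : WithTop ℕ∞) (fun y => monomial (L := L) n (toTorus y)) := by
  simp_rw [monomial_toTorus]
  have h : ∀ i : Fin d, ContDiff ℝ ((⊤ : ℕ∞) : WithTop ℕ∞) (fun y : Fin d → ℝ => (y i : ℂ)) :=
    fun i => Complex.ofRealCLM.contDiff.comp (contDiff_apply ℝ ℝ i)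
  exact ContDiff.cexp (ContDiff.sum fun i _ => (contDiff_const.mul (h i)).div_const _)

/-- Unnormalised Fourier coefficients on the torus of side length `L`. -/
noncomputable def coeff (f : Torus d L → ℝ) (n : Fin d → ℤ) : ℂ :=
  ∫ x, f x * monomial n x

theorem integrable_mul_monomial {f : Torus d L → ℝ} (hf : MemLp f 2 volume) (n : Fin d → ℤ) :
    Integrable (fun x => (f x : ℂ) * monomial n x) volume := by
  refine (hf.integrable one_le_two).ofReal.mul_bdd (c := 1)
    (continuous_monomial n).aestronglyMeasurable (Filter.Eventually.of_forall fun x => ?_)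
  exact ((UnitAddTorus.mFourier n).norm_coe_le_norm _).trans UnitAddTorus.mFourier_norm.le

theorem coeff_eq {f : Torus d L → ℝ} (hf : MemLp f 2 volume) (n : Fin d → ℤ) :
    coeff f n = ((∫ x, f x * (monomial n x).re : ℝ) : ℂ) +
      ((∫ x, f x * (monomial n x).im : ℝ) : ℂ) * Complex.I := by
  have h := integrable_mul_monomial hf n
  rw [coeff, ← integral_re_add_im h]
  simp

/-- Integration by parts against a monomial. Test functions are real, so its real and imaginary
parts are tested separately. -/
theorem HasH1Gradient.coeff_mul {f : Torus d L → ℝ} {g : Fin d → Torus d L → ℝ}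
    (h : HasH1Gradient f g) (n : Fin d → ℤ) (i : Fin d) :
    (2 * Real.pi * n i / L : ℝ) * Complex.I * coeff f n = - coeff (g i) n := by
  have hre := h.integral_eq i (fun x => (monomial n x).re)
    (Complex.reCLM.contDiff.comp (contDiff_monomial n))
  have him := h.integral_eq i (fun x => (monomial n x).im)
    (Complex.imCLM.contDiff.comp (contDiff_monomial n))
  have hdre : ∀ x : Torus d L, partialDeriv i (fun x => (monomial n x).re) x =
      -(2 * Real.pi * n i / L) * (monomial n x).im := fun x => by
    have := (Complex.reCLM.hasFDerivAt.comp_hasDerivAt (0 : ℝ) (hasDerivAt_monomial n x i)).deriv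
    refine this.trans ?_
    simp [-Complex.ofReal_div, -Complex.ofReal_mul]
    ring
  have hdim : ∀ x : Torus d L, partialDeriv i (fun x => (monomial n x).im) x =
      (2 * Real.pi * n i / L) * (monomial n x).re := fun x => by
    have := (Complex.imCLM.hasFDerivAt.comp_hasDerivAt (0 : ℝ) (hasDerivAt_monomial n x i)).deriv
    refine this.trans ?_
    simp
    ring
  simp_rw [hdre, mul_left_comm (_ : ℝ) (-(2 * Real.pi * n i / L) : ℝ), integral_const_mul] at hre
  simp_rw [hdim, mul_left_comm (_ : ℝ) (2 * Real.pi * n i / L : ℝ), integral_const_mul] at him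
  rw [coeff_eq h.memLp, coeff_eq (h.memLp_grad i)]
  apply Complex.ext
  · simp only [Complex.mul_re, Complex.add_re, Complex.neg_re, Complex.ofReal_re, Complex.ofReal_im,
      Complex.I_re, Complex.I_im, Complex.mul_im, Complex.add_im]
    linarith
  · simp only [Complex.mul_re, Complex.add_re, Complex.neg_im, Complex.ofReal_re, Complex.ofReal_im,
      Complex.I_re, Complex.I_im, Complex.mul_im, Complex.add_im]
    linarith

variable (d L) in
theorem exists_parseval : ∃ c : ℝ, 0 < c ∧ ∀ f : Torus d L → ℝ, MemLp f 2 volume →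
    HasSum (fun n => ‖coeff f n‖ ^ 2) (c * ∫ x, f x ^ 2) := by
  obtain ⟨c, hc, hv⟩ := exists_volume_unit_eq d L
  have hc' : (0 : ℝ) < c := hc
  refine ⟨(c : ℝ)⁻¹, inv_pos.2 hc', fun f hf => ?_⟩
  have hme : MeasurableEmbedding (toUnit d L) :=
    (Homeomorph.mk (toUnit d L).toEquiv continuous_toUnit
      continuous_toUnit_symm).measurableEmbedding
  have hint : ∀ F : UnitAddTorus (Fin d) → ℂ,
      ∫ t, F t = (c : ℂ) * ∫ x : Torus d L, F (toUnit d L x) := fun F => by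
    rw [hv, integral_smul_nnreal_measure, hme.integral_map]
    rfl
  have hF : MemLp (fun t => (f ((toUnit d L).symm t) : ℂ)) 2
      (volume : Measure (UnitAddTorus (Fin d))) := by
    rw [hv]
    refine MemLp.smul_measure ?_ ENNReal.coe_ne_top
    rw [hme.memLp_map_measure_iff]
    simpa [Function.comp_def] using hf.ofReal (K := ℂ)
  have key := UnitAddTorus.hasSum_sq_mFourierCoeff (hF.toLp _)
  have h1 : ∀ n, UnitAddTorus.mFourierCoeff (hF.toLp _) n = (c : ℂ) * coeff f (-n) := fun n => by
    have : UnitAddTorus.mFourierCoeff (hF.toLp _) n = UnitAddTorus.mFourierCoeff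
        (fun t => (f ((toUnit d L).symm t) : ℂ)) n :=
      integral_congr_ae (Filter.EventuallyEq.rfl.mul hF.coeFn_toLp)
    rw [this, UnitAddTorus.mFourierCoeff, hint]
    simp [coeff, monomial, mul_comm]
  have h2 : ∫ t, ‖hF.toLp _ t‖ ^ 2 = (c : ℝ) * ∫ x, f x ^ 2 := by
    have : ∫ t, ‖hF.toLp _ t‖ ^ 2 = ∫ t, (f ((toUnit d L).symm t)) ^ 2 := by
      refine integral_congr_ae ?_
      filter_upwards [hF.coeFn_toLp] with t ht
      rw [ht]
      simp
    rw [this, hv, integral_smul_nnreal_measure, hme.integral_map]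
    simp [NNReal.smul_def]
  simp_rw [h1, h2, norm_mul, mul_pow] at key
  -- `coeff` integrates against the monomial itself, not its conjugate, hence the reindexing n ↦ -n.
  have key2 := (Equiv.neg (Fin d → ℤ)).hasSum_iff.2 key
  have hc0 : (c : ℝ) ≠ 0 := hc'.ne'
  have e1 : (fun n => ‖coeff f n‖ ^ 2) = fun n => ((c : ℝ) ^ 2)⁻¹ *
      ((fun i => ‖((c : ℝ) : ℂ)‖ ^ 2 * ‖coeff f (-i)‖ ^ 2) ∘ Equiv.neg (Fin d → ℤ)) n := by
    funext n
    simp [hc0]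
  have e2 : (c : ℝ)⁻¹ * ∫ x, f x ^ 2 = ((c : ℝ) ^ 2)⁻¹ * (c * ∫ x, f x ^ 2) := by
    field_simp
  rw [e1, e2]
  exact key2.mul_left _

/-- **Poincaré's inequality** on the torus. -/
theorem poincare {f : Torus d L → ℝ} {g : Fin d → Torus d L → ℝ} (h : HasH1Gradient f g) :
    ∫ x, (f x - (L ^ d)⁻¹ * ∫ y, f y) ^ 2 ≤ (L / (2 * Real.pi)) ^ 2 * ∑ i, ∫ x, g i x ^ 2 := by
  have hL : (0 : ℝ) < L := Fact.out
  obtain ⟨c, hc, hP⟩ := exists_parseval d L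
  have hv := h.sub_const ((L ^ d)⁻¹ * ∫ y, f y)
  have h1 := hP _ hv.memLp
  have h2 := (hasSum_sum fun i (_ : i ∈ Finset.univ) => hP _ (h.memLp_grad i)).mul_left
    ((L / (2 * Real.pi)) ^ 2)
  have h3 := hasSum_le (fun n => ?_) h1 h2
  · rw [← Finset.mul_sum, mul_left_comm] at h3
    exact le_of_mul_le_mul_left h3 hc
  -- Mode by mode: subtracting the mean kills n = 0; otherwise some |nᵢ| ≥ 1, and the i-th
  -- derivative alone controls the coefficient.
  by_cases hn : n = 0
  · subst hn
    have h0 : coeff (fun x => f x - (L ^ d)⁻¹ * ∫ y, f y) 0 = 0 := by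
      have e : ∀ x : Torus d L, monomial 0 x = 1 := fun x => by
        simp [monomial, UnitAddTorus.mFourier_zero]
      rw [coeff]
      simp_rw [e, mul_one]
      rw [integral_complex_ofReal, integral_sub (h.memLp.integrable one_le_two) (integrable_const _),
        integral_const, volume_real_univ, smul_eq_mul, mul_inv_cancel_left₀ (by positivity),
        sub_self, Complex.ofReal_zero]
    rw [h0]
    have : 0 ≤ ∑ i, ‖coeff (g i) (0 : Fin d → ℤ)‖ ^ 2 := by positivity
    simp only [norm_zero]
    nlinarith [sq_nonneg (L / (2 * Real.pi))]
  · obtain ⟨i, hi⟩ := Function.ne_iff.1 hn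
    have hi1 : (1 : ℝ) ≤ (n i : ℝ) ^ 2 := by
      have : (1 : ℤ) ≤ (n i) ^ 2 := Int.add_one_le_iff.2 (sq_pos_of_ne_zero hi)
      exact_mod_cast this
    have hk := congrArg (fun z : ℂ => ‖z‖ ^ 2) (hv.coeff_mul n i)
    simp only [norm_mul, norm_neg, Complex.norm_I, mul_one, Complex.norm_real, mul_pow,
      Real.norm_eq_abs, sq_abs] at hk
    have hs : ‖coeff (g i) n‖ ^ 2 ≤ ∑ j, ‖coeff (g j) n‖ ^ 2 :=
      Finset.single_le_sum (f := fun j => ‖coeff (g j) n‖ ^ 2) (fun j _ => by positivity)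
        (Finset.mem_univ i)
    refine le_trans ?_ (mul_le_mul_of_nonneg_left hs (by positivity))
    rw [← hk, ← mul_assoc, ← mul_pow]
    have : L / (2 * Real.pi) * (2 * Real.pi * n i / L) = n i := by
      have := Real.pi_pos
      field_simp
    rw [this]
    exact le_mul_of_one_le_left (by positivity) hi1

end Fourier

/-! ### Convolution with W and the interaction energy. -/

section Convolution

variable {d : ℕ} {L : ℝ} [Fact (0 < L)]

theorem exists_bound_of_continuous {W : Torus d L → ℝ} (hW : Continuous W) :
    ∃ B, ∀ x, |W x| ≤ B := by
  obtain ⟨B, hB⟩ := (isCompact_univ (X := Torus d L)).exists_bound_of_continuousOn hW.continuousOn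
  exact ⟨B, fun x => hB x (Set.mem_univ x)⟩

variable {W ρ : Torus d L → ℝ}

theorem integrable_conv_integrand (hW : Continuous W) (hρ : Integrable ρ volume) (x : Torus d L) :
    Integrable (fun y => W (x - y) * ρ y) volume := by
  obtain ⟨B, hB⟩ := exists_bound_of_continuous hW
  exact hρ.bdd_mul (hW.comp (continuous_const.sub continuous_id)).aestronglyMeasurable
    (Filter.Eventually.of_forall fun y => hB _)

theorem conv_congr_ae {σ : Torus d L → ℝ} (h : ρ =ᵐ[volume] σ) : conv W ρ = conv W σ := by
  funext x
  refine integral_congr_ae ?_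
  filter_upwards [h] with y hy
  rw [hy]

theorem conv_const (hWmean : ∫ x, W x = 0) (c : ℝ) : conv W (fun _ : Torus d L => c) = 0 := by
  funext x
  simp [conv, integral_mul_const, integral_sub_left_eq_self W, hWmean]

theorem conv_sub_const (hW : Continuous W) (hWmean : ∫ x, W x = 0) (hρ : Integrable ρ volume)
    (c : ℝ) : conv W (fun x => ρ x - c) = conv W ρ := by
  funext x
  have h := congrFun (conv_const hWmean c) x
  simp only [conv, Pi.zero_apply] at h ⊢
  simp_rw [mul_sub]
  rw [integral_sub (integrable_conv_integrand hW hρ x)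
    (integrable_conv_integrand hW (integrable_const c) x), h, sub_zero]

theorem abs_conv_le {B : ℝ} (hW : Continuous W) (hB : ∀ x, |W x| ≤ B)
    (hρ : Integrable ρ volume) (x : Torus d L) : |conv W ρ x| ≤ B * ∫ y, |ρ y| := by
  rw [← integral_const_mul]
  refine (norm_integral_le_integral_norm _).trans
    (integral_mono (integrable_conv_integrand hW hρ x).norm (hρ.abs.const_mul B) fun y => ?_)
  simp only [Real.norm_eq_abs, abs_mul]
  exact mul_le_mul_of_nonneg_right (hB _) (abs_nonneg _)

theorem continuous_conv (hW : Continuous W) (hρ : Integrable ρ volume) :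
    Continuous (conv W ρ) := by
  obtain ⟨B, hB⟩ := exists_bound_of_continuous hW
  refine continuous_of_dominated (bound := fun y => B * |ρ y|)
    (fun x => (integrable_conv_integrand hW hρ x).aestronglyMeasurable)
    (fun x => Filter.Eventually.of_forall fun y => ?_) (hρ.abs.const_mul B)
    (Filter.Eventually.of_forall fun y =>
      (hW.comp (continuous_id.sub continuous_const)).mul continuous_const)
  rw [Real.norm_eq_abs, abs_mul]
  exact mul_le_mul_of_nonneg_right (hB _) (abs_nonneg _)

/-- The Lipschitz bound of W passes to W ⋆ ρ and bounds `deriv` whether or not the derivative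
exists. -/
theorem abs_partialDeriv_conv_le {K : ℝ} (hW : Continuous W) (hK0 : 0 ≤ K)
    (hK : ∀ (i : Fin d) (x : Torus d L), ∀ s ∈ Set.Icc (-1 : ℝ) 1, ∀ t ∈ Set.Icc (-1 : ℝ) 1,
      |W (x + Pi.single i (t : AddCircle L)) - W (x + Pi.single i (s : AddCircle L))|
        ≤ K * |t - s|) (hρ : Integrable ρ volume) (i : Fin d) (x : Torus d L) :
    |partialDeriv i (conv W ρ) x| ≤ K * ∫ y, |ρ y| := by
  rw [partialDeriv, ← Real.norm_eq_abs]
  refine norm_deriv_le_of_lip' (by positivity) ?_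
  filter_upwards [Icc_mem_nhds (show (-1 : ℝ) < 0 by norm_num) one_pos] with t ht
  simp only [conv]
  rw [← integral_sub (integrable_conv_integrand hW hρ _) (integrable_conv_integrand hW hρ _),
    mul_right_comm, ← integral_const_mul]
  refine (norm_integral_le_integral_norm _).trans (integral_mono
    ((integrable_conv_integrand hW hρ _).sub (integrable_conv_integrand hW hρ _)).norm
    (hρ.abs.const_mul _) fun y => ?_)
  simp only [Real.norm_eq_abs, ← sub_mul, abs_mul]
  refine mul_le_mul_of_nonneg_right ?_ (abs_nonneg _)
  simpa [add_sub_right_comm] using hK i (x - y) 0 (by norm_num) t ht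

theorem integral_conv_eq_zero (hW : Continuous W) (hWmean : ∫ x, W x = 0)
    (hρ : Integrable ρ volume) : ∫ x, conv W ρ x = 0 := by
  obtain ⟨B, hB⟩ := exists_bound_of_continuous hW
  have h : Integrable (fun p : Torus d L × Torus d L => W (p.1 - p.2) * ρ p.2)
      (volume.prod volume) :=
    (hρ.comp_snd volume).bdd_mul (hW.comp (continuous_fst.sub continuous_snd)).aestronglyMeasurable
      (Filter.Eventually.of_forall fun y => hB _)
  simp only [conv]
  rw [integral_integral_swap h]
  simp_rw [integral_mul_const, integral_sub_right_eq_self W, hWmean, zero_mul, integral_zero]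

theorem interactionEnergy_eq : interactionEnergy W ρ = 1 / 2 * ∫ x, ρ x * conv W ρ x := by
  simp only [interactionEnergy, conv, ← integral_const_mul]
  congr! 5
  ring

/-- The cross terms vanish: W ⋆ c = 0, and W ⋆ ρ has mean zero. -/
theorem interactionEnergy_sub_const (hW : Continuous W) (hWmean : ∫ x, W x = 0)
    (hρ : Integrable ρ volume) (c : ℝ) :
    interactionEnergy W (fun x => ρ x - c) = interactionEnergy W ρ := by
  obtain ⟨B, hB⟩ := exists_bound_of_continuous (continuous_conv hW hρ)
  have hc := (continuous_conv hW hρ).aestronglyMeasurable (μ := volume)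
  rw [interactionEnergy_eq, interactionEnergy_eq, conv_sub_const hW hWmean hρ]
  simp_rw [sub_mul]
  rw [integral_sub (hρ.mul_bdd hc (Filter.Eventually.of_forall hB))
    ((integrable_of_continuous (continuous_conv hW hρ)).const_mul c), integral_const_mul,
    integral_conv_eq_zero hW hWmean hρ, mul_zero, sub_zero]

theorem abs_interactionEnergy_le {B : ℝ} (hW : Continuous W) (hB : ∀ x, |W x| ≤ B)
    (hρ : Integrable ρ volume) :
    |interactionEnergy W ρ| ≤ B / 2 * (∫ y, |ρ y|) ^ 2 := by
  have hb := abs_conv_le hW hB hρ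
  have h : |∫ x, ρ x * conv W ρ x| ≤ (B * ∫ y, |ρ y|) * ∫ y, |ρ y| := by
    rw [← integral_const_mul]
    refine (norm_integral_le_integral_norm _).trans (integral_mono (Integrable.norm
      (hρ.mul_bdd (continuous_conv hW hρ).aestronglyMeasurable (Filter.Eventually.of_forall hb)))
      (hρ.abs.const_mul _) fun x => ?_)
    simp only [Real.norm_eq_abs, abs_mul]
    rw [mul_comm]
    exact mul_le_mul_of_nonneg_right (hb x) (abs_nonneg _)
  rw [interactionEnergy_eq, abs_mul, abs_of_pos (by norm_num : (0 : ℝ) < 1 / 2)]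
  linarith

end Convolution

/-! ### Densities and the flat state. -/

section Density

variable {d : ℕ} {L : ℝ} [Fact (0 < L)] {μ : ProbabilityMeasure (Torus d L)}

theorem density_nonneg (x : Torus d L) : 0 ≤ density μ x := ENNReal.toReal_nonneg

theorem integrable_density : Integrable (density μ) volume := Measure.integrable_toReal_rnDeriv

theorem integral_density (h : (μ : Measure (Torus d L)) ≪ volume) : ∫ x, density μ x = 1 := by
  simp only [density]
  rw [Measure.integral_toReal_rnDeriv h]
  simp

variable (d L) in
theorem flatState_absolutelyContinuous : (flatState d L : Measure (Torus d L)) ≪ volume :=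
  withDensity_absolutelyContinuous _ _

variable (d L) in
theorem density_flatState : density (flatState d L) =ᵐ[volume] fun _ => (L ^ d)⁻¹ := by
  have hL : (0 : ℝ) < L := Fact.out
  filter_upwards [Measure.rnDeriv_withDensity (volume : Measure (Torus d L))
    (measurable_const (a := ENNReal.ofReal ((L ^ d)⁻¹)))] with x hx
  rw [density]
  refine (congrArg ENNReal.toReal hx).trans (ENNReal.toReal_ofReal (by positivity))

theorem eq_flatState (h : (μ : Measure (Torus d L)) ≪ volume)
    (hd : density μ =ᵐ[volume] fun _ => (L ^ d)⁻¹) : μ = flatState d L := by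
  apply Subtype.ext
  change (μ : Measure (Torus d L)) = volume.withDensity _
  rw [← Measure.withDensity_rnDeriv_eq _ _ h]
  refine withDensity_congr_ae ?_
  filter_upwards [hd, Measure.rnDeriv_lt_top (μ : Measure (Torus d L)) volume] with x hx hx2
  rw [← hx, density, ENNReal.ofReal_toReal hx2.ne]

theorem isStationarySolution_flatState {W : Torus d L → ℝ} (hWmean : ∫ x, W x = 0) (β m : ℝ) :
    IsStationarySolution β m W (flatState d L) := by
  have hf := density_flatState d L
  refine ⟨flatState_absolutelyContinuous d L, (memLp_const _).ae_eq hf.symm,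
    (memLp_const _).ae_eq hf.symm, fun _ _ => 0, ?_, fun φ ψ _ => ?_⟩
  · have h := hasH1Gradient_const (d := d) (L := L) (((L ^ d)⁻¹) ^ m)
    have e : (fun x => density (flatState d L) x ^ m) =ᵐ[volume] fun _ => ((L ^ d)⁻¹) ^ m := by
      filter_upwards [hf] with x hx
      rw [hx]
    refine ⟨h.memLp.ae_eq e.symm, h.memLp_grad, fun i φ hφ => ?_⟩
    rw [← h.integral_eq i φ hφ]
    exact integral_congr_ae (e.mul Filter.EventuallyEq.rfl)
  · rw [conv_congr_ae hf, conv_const hWmean]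
    simp [partialDeriv]

end Density

/-! ### Scalar convexity inequalities and Cauchy–Schwarz. -/

section Inequalities

/-- In s^m - c^m = (s^{m-1} - c^{m-1}) s + c^{m-1} (s - c) the two terms never have opposite signs.
-/
theorem rpow_mul_abs_sub_le {m s c : ℝ} (hm : 1 < m) (hs : 0 ≤ s) (hc : 0 ≤ c) :
    c ^ (m - 1) * |s - c| ≤ |s ^ m - c ^ m| := by
  have e : ∀ r : ℝ, 0 ≤ r → r ^ m = r ^ (m - 1) * r := fun r hr => by
    rw [← Real.rpow_add_one' hr (by linarith), sub_add_cancel]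
  rw [e s hs, e c hc]
  rcases le_total c s with h | h
  · have := Real.rpow_le_rpow hc h (by linarith : 0 ≤ m - 1)
    rw [abs_of_nonneg (by linarith)]
    refine le_trans ?_ (le_abs_self _)
    nlinarith
  · have := Real.rpow_le_rpow hs h (by linarith : 0 ≤ m - 1)
    rw [abs_of_nonpos (by linarith)]
    refine le_trans ?_ (neg_le_abs _)
    nlinarith

/-- With q = √s, both sides compare with (m-1)(q-1)²: e^u ≥ 1 + u and log q ≥ 1 - 1/q bound the
right side below by it, and (q+1)² ≤ 2(q²+1) bounds the left side above. -/
theorem sq_div_le_rpow_sub {m s : ℝ} (hm : 1 < m) (hs : 0 ≤ s) :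
    (m - 1) / 2 * ((s - 1) ^ 2 / (s + 1)) ≤ s ^ m - 1 - m * (s - 1) := by
  rcases hs.eq_or_lt with rfl | hs
  · rw [Real.zero_rpow (by linarith)]
    linarith
  have h1 : s + (m - 1) * (s * Real.log s) ≤ s ^ m := by
    have e : s ^ m = s * s ^ (m - 1) := by
      rw [← Real.rpow_one_add' hs.le (by linarith)]
      congr 1
      ring
    rw [e, Real.rpow_def_of_pos hs]
    nlinarith [Real.add_one_le_exp (Real.log s * (m - 1))]
  have hq := Real.sqrt_pos.2 hs
  have hq2 := Real.sq_sqrt hs.le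
  set q := Real.sqrt s
  have h2 : 2 * (s - q) ≤ s * Real.log s := by
    have := Real.one_sub_inv_le_log_of_pos hq
    rw [← hq2, Real.log_pow]
    have e : q ^ 2 - q = q ^ 2 * (1 - q⁻¹) := by
      field_simp
    rw [e]
    push_cast
    nlinarith [sq_nonneg q]
  have h3 : (s - 1) ^ 2 / (s + 1) ≤ 2 * (q - 1) ^ 2 := by
    rw [div_le_iff₀ (by positivity), ← hq2]
    nlinarith [sq_nonneg ((q - 1) * (q - 1))]
  nlinarith

/-- A quantified strict convexity inequality for `s ↦ s ^ m`. -/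
theorem tangent_add_le_rpow {m s a : ℝ} (hm : 1 < m) (hs : 0 ≤ s) (ha : 0 < a) (t : ℝ) :
    a ^ m + m * a ^ (m - 1) * (s - a) +
      (m - 1) / 2 * a ^ (m - 1) * (2 * t * |s - a| - t ^ 2 * (s + a)) ≤ s ^ m := by
  have hsa : 0 < s + a := by linarith
  have h1 := mul_le_mul_of_nonneg_left (sq_div_le_rpow_sub hm (div_nonneg hs ha.le))
    (Real.rpow_nonneg ha.le m)
  have hp : 0 < a ^ (m - 1) := Real.rpow_pos_of_pos ha _
  have e : a ^ m = a ^ (m - 1) * a := by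
    rw [← Real.rpow_add_one' ha.le (by linarith), sub_add_cancel]
  have e2 : s ^ m = a ^ m * (s / a) ^ m := by
    rw [← Real.mul_rpow ha.le (by positivity), mul_div_cancel₀ _ ha.ne']
  have e3 : a ^ m * ((m - 1) / 2 * ((s / a - 1) ^ 2 / (s / a + 1))) =
      (m - 1) / 2 * a ^ (m - 1) * ((s - a) ^ 2 / (s + a)) := by
    rw [e]
    field_simp
  have e4 : a ^ m * ((s / a) ^ m - 1 - m * (s / a - 1)) =
      s ^ m - a ^ m - m * a ^ (m - 1) * (s - a) := by
    rw [e2, e]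
    field_simp
  rw [e3, e4] at h1
  -- The quotient is replaced by a minorant involving only |s - a| and s + a, whose integrals are
  -- available; optimising over t after integration plays the role of Cauchy–Schwarz.
  have h2 : 2 * t * |s - a| - t ^ 2 * (s + a) ≤ (s - a) ^ 2 / (s + a) := by
    rw [le_div_iff₀ hsa, ← sq_abs (s - a)]
    nlinarith [sq_nonneg (|s - a| - t * (s + a))]
  have h3 := mul_le_mul_of_nonneg_left h2
    (show 0 ≤ (m - 1) / 2 * a ^ (m - 1) by have := sub_pos.2 hm; positivity)
  linarith

theorem sq_integral_abs_le {α : Type*} [MeasurableSpace α] {ν : Measure α} [IsFiniteMeasure ν]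
    {f : α → ℝ} (hf : MemLp f 2 ν) :
    (∫ x, |f x| ∂ν) ^ 2 ≤ ν.real Set.univ * ∫ x, f x ^ 2 ∂ν := by
  set N := ∫ x, |f x| ∂ν
  set V := ν.real Set.univ
  have hi : Integrable (fun x => |f x|) ν := (hf.integrable one_le_two).abs
  have h : 0 ≤ ∫ x, (V * |f x| - N) ^ 2 ∂ν := integral_nonneg fun _ => sq_nonneg _
  have e : ∀ x, (V * |f x| - N) ^ 2 = V ^ 2 * f x ^ 2 - 2 * V * N * |f x| + N ^ 2 := fun x => by
    rw [← sq_abs (f x)]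
    ring
  simp_rw [e] at h
  have hi2 : Integrable (fun x => V ^ 2 * f x ^ 2 - 2 * V * N * |f x|) ν :=
    (hf.integrable_sq.const_mul _).sub (hi.const_mul _)
  rw [integral_add hi2 (integrable_const _), integral_sub (hf.integrable_sq.const_mul _) (hi.const_mul _), integral_const_mul,
    integral_const_mul, integral_const, smul_eq_mul] at h
  change 0 ≤ V ^ 2 * _ - 2 * V * N * N + V * N ^ 2 at h
  rcases (measureReal_nonneg (μ := ν) (s := Set.univ)).eq_or_lt with h0 | h0
  · have : ν = 0 := by
      rw [← Measure.measure_univ_eq_zero]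
      exact (measureReal_eq_zero_iff).1 h0.symm
    simp [N, V, this]
  · change 0 < V at h0
    have : 0 ≤ V * (V * ∫ x, f x ^ 2 ∂ν - N ^ 2) := by linarith
    linarith [nonneg_of_mul_nonneg_right this h0]

end Inequalities

/-! ### Entropy controls the L¹ distance to the flat state. -/

section Entropy

variable {d : ℕ} {L : ℝ} [Fact (0 < L)] {μ : ProbabilityMeasure (Torus d L)}

theorem le_integral_density_rpow {m : ℝ} (hm : 1 < m) (h : (μ : Measure (Torus d L)) ≪ volume)
    (hi : Integrable (fun x => density μ x ^ m) volume) :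
    L ^ d * ((L ^ d)⁻¹) ^ m +
      (m - 1) / 4 * ((L ^ d)⁻¹) ^ (m - 1) * (∫ x, |density μ x - (L ^ d)⁻¹|) ^ 2 ≤
      ∫ x, density μ x ^ m := by
  have hL : (0 : ℝ) < L := Fact.out
  have hV : 0 < L ^ d := pow_pos hL d
  set a := (L ^ d)⁻¹
  have ha : 0 < a := inv_pos.2 hV
  have hVa : L ^ d * a = 1 := mul_inv_cancel₀ hV.ne'
  set N := ∫ x, |density μ x - a|
  have i0 : Integrable (fun _ : Torus d L => a ^ m) volume := integrable_const _
  have i1 : Integrable (fun x => density μ x - a) volume :=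
    integrable_density.sub (integrable_const _)
  have i2 : Integrable (fun x => density μ x + a) volume :=
    integrable_density.add (integrable_const _)
  have I1 : ∫ x, (density μ x - a) = 0 := by
    rw [integral_sub integrable_density (integrable_const _), integral_density h, integral_const,
      volume_real_univ, smul_eq_mul, hVa, sub_self]
  have I2 : ∫ x, (density μ x + a) = 2 := by
    rw [integral_add integrable_density (integrable_const _), integral_density h, integral_const,
      volume_real_univ, smul_eq_mul, hVa]
    norm_num
  have j1 : Integrable (fun x => a ^ m + m * a ^ (m - 1) * (density μ x - a)) volume :=
    i0.add (i1.const_mul _)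
  have j2 : Integrable (fun x => 2 * (N / 2) * |density μ x - a| -
      (N / 2) ^ 2 * (density μ x + a)) volume := (i1.abs.const_mul _).sub (i2.const_mul _)
  -- Since ∫(ρ + a) = 2, the integrated gain 2tN - 2t² is largest at t = N/2, where it equals N²/2.
  have key := integral_mono (j1.add (j2.const_mul ((m - 1) / 2 * a ^ (m - 1)))) hi
    fun x => tangent_add_le_rpow hm (density_nonneg x) ha (N / 2)
  refine le_trans (le_of_eq ?_) key
  simp only [Pi.add_apply]
  rw [integral_add j1 (j2.const_mul _), integral_add i0 (i1.const_mul _), integral_const_mul,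
    integral_const_mul, integral_sub (i1.abs.const_mul _) (i2.const_mul _), integral_const_mul,
    integral_const_mul, I1, I2, integral_const, volume_real_univ, smul_eq_mul]
  ring

theorem eq_flatState_of_integral_abs_eq_zero (h : (μ : Measure (Torus d L)) ≪ volume)
    (h0 : ∫ x, |density μ x - (L ^ d)⁻¹| = 0) : μ = flatState d L := by
  refine eq_flatState h ?_
  have hi : Integrable (fun x => density μ x - (L ^ d)⁻¹) volume :=
    integrable_density.sub (integrable_const _)
  rw [integral_eq_zero_iff_of_nonneg (fun _ => abs_nonneg _) hi.abs] at h0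
  filter_upwards [h0] with x hx
  exact sub_eq_zero.1 (abs_eq_zero.1 hx)

end Entropy

/-! ### The flat state is the unique minimiser. -/

section Minimiser

variable {d : ℕ} {L : ℝ} [Fact (0 < L)] {W : Torus d L → ℝ}

theorem freeEnergy_flatState (hWmean : ∫ x, W x = 0) (β m : ℝ) :
    freeEnergy β m W (flatState d L) =
      ((β⁻¹ / (m - 1) * (L ^ d * ((L ^ d)⁻¹) ^ m) - β⁻¹ / (m - 1) : ℝ) : EReal) := by
  have hf := density_flatState d L
  rw [freeEnergy, if_pos ⟨flatState_absolutelyContinuous d L, (memLp_const _).ae_eq hf.symm⟩,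
    interactionEnergy_eq, conv_congr_ae hf, conv_const hWmean, entropy]
  have e : ∫ x, density (flatState d L) x ^ m = L ^ d * ((L ^ d)⁻¹) ^ m := by
    have : (fun x => density (flatState d L) x ^ m) =ᵐ[volume] fun _ => ((L ^ d)⁻¹) ^ m := by
      filter_upwards [hf] with x hx
      rw [hx]
    rw [integral_congr_ae this, integral_const, volume_real_univ, smul_eq_mul]
  rw [e]
  simp

theorem eq_flatState_of_freeEnergy_le {B β m : ℝ} (hW : Continuous W) (hB : ∀ x, |W x| ≤ B)
    (hWmean : ∫ x, W x = 0) (hm : 1 < m) (hβ : 0 < β)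
    (hβB : β * (2 * B) < ((L ^ d)⁻¹) ^ (m - 1)) {μ : ProbabilityMeasure (Torus d L)}
    (h : freeEnergy β m W μ ≤ freeEnergy β m W (flatState d L)) : μ = flatState d L := by
  rw [freeEnergy_flatState hWmean, freeEnergy] at h
  split_ifs at h with hc
  swap
  · exact absurd h (not_le.2 (EReal.coe_lt_top _))
  obtain ⟨hac, hLp⟩ := hc
  rw [EReal.coe_le_coe_iff, entropy] at h
  have hi : Integrable (fun x => density μ x ^ m) volume := by
    have := hLp.integrable_norm_rpow (by simpa using by linarith) ENNReal.ofReal_ne_top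
    rw [ENNReal.toReal_ofReal (by linarith)] at this
    simpa [abs_of_nonneg (density_nonneg _)] using this
  have h1 := le_integral_density_rpow hm hac hi
  have hi1 : Integrable (fun x => density μ x - (L ^ d)⁻¹) volume :=
    integrable_density.sub (integrable_const _)
  have hI := abs_interactionEnergy_le hW hB hi1
  rw [interactionEnergy_sub_const hW hWmean integrable_density] at hI
  apply eq_flatState_of_integral_abs_eq_zero hac
  set N := ∫ x, |density μ x - (L ^ d)⁻¹|
  set p := ((L ^ d)⁻¹ : ℝ) ^ (m - 1)
  have hm1 : 0 < m - 1 := sub_pos.2 hm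
  have h2 := mul_le_mul_of_nonneg_left h1 (show 0 ≤ β⁻¹ / (m - 1) by positivity)
  have e : β⁻¹ / (m - 1) * (L ^ d * ((L ^ d)⁻¹) ^ m + (m - 1) / 4 * p * N ^ 2) =
      β⁻¹ / (m - 1) * (L ^ d * ((L ^ d)⁻¹) ^ m) + β⁻¹ * p / 4 * N ^ 2 := by
    field_simp
  rw [e] at h2
  have h3 := (abs_le.1 hI).1
  have h4 : 2 * B < β⁻¹ * p := by
    rw [inv_mul_eq_div, lt_div_iff₀ hβ]
    linarith
  have h5 : (β⁻¹ * p - 2 * B) * N ^ 2 ≤ 0 := by linarith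
  have h6 : N ^ 2 ≤ 0 := nonpos_of_mul_nonpos_right h5 (by linarith)
  exact pow_eq_zero_iff two_ne_zero |>.1 (le_antisymm h6 (sq_nonneg N))

theorem isFreeEnergyMinimiser_iff {B β m : ℝ} (hW : Continuous W) (hB : ∀ x, |W x| ≤ B)
    (hWmean : ∫ x, W x = 0) (hm : 1 < m) (hβ : 0 < β)
    (hβB : β * (2 * B) < ((L ^ d)⁻¹) ^ (m - 1)) (μ : ProbabilityMeasure (Torus d L)) :
    IsFreeEnergyMinimiser β m W μ ↔ μ = flatState d L := by
  refine ⟨fun h => eq_flatState_of_freeEnergy_le hW hB hWmean hm hβ hβB (h _), ?_⟩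
  rintro rfl ν
  rcases le_total (freeEnergy β m W (flatState d L)) (freeEnergy β m W ν) with h | h
  · exact h
  · exact (congrArg _ (eq_flatState_of_freeEnergy_le hW hB hWmean hm hβ hβB h)).ge

end Minimiser

/-! ### The flat state is the unique stationary solution. -/

section Stationary

variable {d : ℕ} {L : ℝ} [Fact (0 < L)] {W : Torus d L → ℝ}

/-- Energy estimate: testing the weak formulation with `ρ ^ m` itself. -/
theorem sum_integral_sq_le {β C : ℝ} (hβ : 0 < β) {ρ : Torus d L → ℝ} (hρ : MemLp ρ 2 volume)
    {g b : Fin d → Torus d L → ℝ} (hg : ∀ i, MemLp (g i) 2 volume)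
    (hbm : ∀ i, AEStronglyMeasurable (b i) volume) (hb : ∀ i x, |b i x| ≤ C)
    (h : ∫ x, ∑ i, (β⁻¹ * g i x + ρ x * b i x) * g i x = 0) :
    ∑ i, ∫ x, g i x ^ 2 ≤ β ^ 2 * (d * C ^ 2 * ∫ x, ρ x ^ 2) := by
  have hint : ∀ i, Integrable (fun x => (β⁻¹ * g i x + ρ x * b i x) * g i x) volume := fun i => by
    have h1 : MemLp (fun x => ρ x * b i x) 2 volume := by
      refine MemLp.of_le_mul (c := C) hρ (hρ.aestronglyMeasurable.mul (hbm i))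
        (Filter.Eventually.of_forall fun x => ?_)
      rw [norm_mul, mul_comm]
      exact mul_le_mul_of_nonneg_right (hb i x) (norm_nonneg _)
    exact MemLp.integrable_mul (((hg i).const_mul β⁻¹).add h1) (hg i)
  have hle : ∀ i, β⁻¹ / 2 * (∫ x, g i x ^ 2) - β / 2 * C ^ 2 * ∫ x, ρ x ^ 2 ≤
      ∫ x, (β⁻¹ * g i x + ρ x * b i x) * g i x := fun i => by
    rw [← integral_const_mul, ← integral_const_mul,
      ← integral_sub ((hg i).integrable_sq.const_mul _) (hρ.integrable_sq.const_mul _)]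
    refine integral_mono (((hg i).integrable_sq.const_mul _).sub (hρ.integrable_sq.const_mul _))
      (hint i) fun x => ?_
    have h1 : b i x ^ 2 ≤ C ^ 2 := sq_le_sq' (abs_le.1 (hb i x)).1 (abs_le.1 (hb i x)).2
    have h2 : β / 2 * (ρ x ^ 2 * b i x ^ 2) ≤ β / 2 * (ρ x ^ 2 * C ^ 2) := by gcongr
    -- Young's inequality, weighted so that half of the diffusion term survives.
    have h3 : 0 ≤ β / 2 * (β⁻¹ * g i x + ρ x * b i x) ^ 2 := by positivity
    have e : β / 2 * (β⁻¹ * g i x + ρ x * b i x) ^ 2 = β⁻¹ / 2 * g i x ^ 2 +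
        ρ x * b i x * g i x + β / 2 * (ρ x ^ 2 * b i x ^ 2) := by
      field_simp
      ring
    rw [e] at h3
    simp only
    linarith
  rw [integral_finsetSum _ fun i _ => hint i] at h
  have hs := Finset.sum_le_sum fun i (_ : i ∈ Finset.univ) => hle i
  rw [h, Finset.sum_sub_distrib, ← Finset.mul_sum, Finset.sum_const, Finset.card_univ,
    Fintype.card_fin, nsmul_eq_mul] at hs
  have := mul_le_mul_of_nonneg_left hs (show 0 ≤ 2 * β by positivity)
  have e : ∀ x y : ℝ, 2 * β * (β⁻¹ / 2 * x - d * (β / 2 * C ^ 2 * y)) =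
    x - β ^ 2 * (d * C ^ 2 * y) := fun x y => by
    field_simp
  rw [e] at this
  linarith

theorem integral_density_sub_sq {μ : ProbabilityMeasure (Torus d L)}
    (hac : (μ : Measure (Torus d L)) ≪ volume) (h2 : MemLp (density μ) 2 volume) (r : ℝ) :
    ∫ x, (density μ x - r) ^ 2 = (∫ x, density μ x ^ 2) - 2 * r + L ^ d * r ^ 2 := by
  have e : ∀ x, (density μ x - r) ^ 2 = density μ x ^ 2 - 2 * r * density μ x + r ^ 2 :=
    fun x => by ring
  have hi : Integrable (fun x => density μ x ^ 2 - 2 * r * density μ x) volume :=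
    h2.integrable_sq.sub (integrable_density.const_mul _)
  simp_rw [e]
  rw [integral_add hi (integrable_const _),
    integral_sub h2.integrable_sq (integrable_density.const_mul _), integral_const_mul,
    integral_density hac, integral_const, volume_real_univ, smul_eq_mul, mul_one]

/-- The variance of `ρ` is controlled by the variance of `ρ ^ m`. -/
theorem integral_density_sq_sub_le {m : ℝ} (hm : 1 < m) {μ : ProbabilityMeasure (Torus d L)}
    (hac : (μ : Measure (Torus d L)) ≪ volume) (h2 : MemLp (density μ) 2 volume)
    (hm2 : MemLp (fun x => density μ x ^ m) 2 volume) :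
    (((L ^ d)⁻¹) ^ (m - 1)) ^ 2 * ((∫ x, density μ x ^ 2) - (L ^ d)⁻¹) ≤
      ∫ x, (density μ x ^ m - (L ^ d)⁻¹ * ∫ y, density μ y ^ m) ^ 2 := by
  have hL : (0 : ℝ) < L := Fact.out
  have hV : 0 < L ^ d := pow_pos hL d
  have hJ := le_integral_density_rpow hm hac (hm2.integrable one_le_two)
  set a := (L ^ d)⁻¹
  have ha : 0 < a := inv_pos.2 hV
  have hVa : L ^ d * a = 1 := mul_inv_cancel₀ hV.ne'
  set u := a * ∫ x, density μ x ^ m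
  have hm0 : m ≠ 0 := by linarith
  have hu : a ^ m ≤ u := by
    have : 0 ≤ (m - 1) / 4 * a ^ (m - 1) * (∫ x, |density μ x - a|) ^ 2 := by
      have := sub_pos.2 hm
      positivity
    have h3 := mul_le_mul_of_nonneg_left (hJ.trans' (le_add_of_nonneg_right this)) ha.le
    rwa [← mul_assoc, mul_comm a, hVa, one_mul] at h3
  have hu0 : 0 ≤ u := (Real.rpow_nonneg ha.le m).trans hu
  -- c is the constant whose m-th power is the mean of ρ^m; Jensen gives c ≥ a, so the slope c^{m-1}
  -- is at least a^{m-1}.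
  obtain ⟨c, hac', hcm⟩ : ∃ c, a ≤ c ∧ c ^ m = u := by
    refine ⟨u ^ m⁻¹, ?_, Real.rpow_inv_rpow hu0 hm0⟩
    rw [← Real.rpow_rpow_inv ha.le hm0]
    exact Real.rpow_le_rpow (Real.rpow_nonneg ha.le m) hu (by positivity)
  have hp : 0 < a ^ (m - 1) := Real.rpow_pos_of_pos ha _
  have hmc : MemLp (fun x => density μ x - c) 2 volume := h2.sub (memLp_const c)
  have hmu : MemLp (fun x => density μ x ^ m - u) 2 volume := hm2.sub (memLp_const u)
  have hS : (a ^ (m - 1)) ^ 2 * ∫ x, (density μ x - c) ^ 2 ≤ ∫ x, (density μ x ^ m - u) ^ 2 := by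
    rw [← integral_const_mul]
    refine integral_mono (hmc.integrable_sq.const_mul _) hmu.integrable_sq fun x => ?_
    have h3 := rpow_mul_abs_sub_le hm (density_nonneg (μ := μ) x) (ha.le.trans hac')
    have h4 : a ^ (m - 1) ≤ c ^ (m - 1) := Real.rpow_le_rpow ha.le hac' (by linarith)
    rw [hcm] at h3
    have h5 : |a ^ (m - 1) * (density μ x - c)| ≤ |density μ x ^ m - u| := by
      rw [abs_mul, abs_of_pos hp]
      exact (mul_le_mul_of_nonneg_right h4 (abs_nonneg _)).trans h3
    simpa only [mul_pow] using sq_le_sq.2 h5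
  refine le_trans (mul_le_mul_of_nonneg_left ?_ (by positivity)) hS
  rw [integral_density_sub_sq hac h2]
  -- This is the excess of ∫(ρ - c)² over the variance about the true mean a.
  have : 0 ≤ L ^ d * (c - a) ^ 2 := by positivity
  generalize L ^ d = V at *
  linear_combination this + (a - 2 * c) * hVa

theorem integral_abs_density_sub_sq_le {μ : ProbabilityMeasure (Torus d L)}
    (hac : (μ : Measure (Torus d L)) ≪ volume) (h2 : MemLp (density μ) 2 volume) :
    (∫ x, |density μ x - (L ^ d)⁻¹|) ^ 2 ≤ L ^ d * ((∫ x, density μ x ^ 2) - (L ^ d)⁻¹) := by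
  have hV : 0 < L ^ d := pow_pos Fact.out d
  have h := sq_integral_abs_le (h2.sub (memLp_const ((L ^ d)⁻¹)))
  simp only [Pi.sub_apply] at h
  rw [volume_real_univ, integral_density_sub_sq hac h2] at h
  refine h.trans_eq ?_
  field_simp
  ring

theorem integral_abs_density_sub_le_two {μ : ProbabilityMeasure (Torus d L)}
    (hac : (μ : Measure (Torus d L)) ≪ volume) :
    ∫ x, |density μ x - (L ^ d)⁻¹| ≤ 2 := by
  have hV : 0 < L ^ d := pow_pos Fact.out d
  have hi : Integrable (fun x => density μ x - (L ^ d)⁻¹) volume :=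
    integrable_density.sub (integrable_const _)
  have hle := integral_mono hi.abs (integrable_density.add (integrable_const ((L ^ d)⁻¹)))
    fun x => (abs_sub _ _).trans_eq (congrArg₂ (· + ·) (abs_of_nonneg (density_nonneg (μ := μ) x))
      (abs_of_pos (inv_pos.2 hV)))
  simp only [Pi.add_apply] at hle
  rw [integral_add integrable_density (integrable_const _), integral_density hac, integral_const,
    volume_real_univ, smul_eq_mul, mul_inv_cancel₀ hV.ne'] at hle
  linarith

theorem IsStationarySolution.eq_flatState {K β m : ℝ} (hW : Continuous W)
    (hWmean : ∫ x, W x = 0) (hm : 1 < m) (hβ : 0 < β) (hK0 : 0 ≤ K)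
    (hK : ∀ (i : Fin d) (x : Torus d L), ∀ s ∈ Set.Icc (-1 : ℝ) 1, ∀ t ∈ Set.Icc (-1 : ℝ) 1,
      |W (x + Pi.single i (t : AddCircle L)) - W (x + Pi.single i (s : AddCircle L))|
        ≤ K * |t - s|)
    (hβK : β ^ 2 * (5 * ((L / (2 * Real.pi)) ^ 2 * (d * K ^ 2))) <
      (((L ^ d)⁻¹) ^ (m - 1)) ^ 2) {μ : ProbabilityMeasure (Torus d L)}
    (h : IsStationarySolution β m W μ) : μ = flatState d L := by
  obtain ⟨hac, h2, -, g, hg, hweak⟩ := h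
  have hV : 0 < L ^ d := pow_pos Fact.out d
  apply eq_flatState_of_integral_abs_eq_zero hac
  have hi1 : Integrable (fun x => density μ x - (L ^ d)⁻¹) volume :=
    integrable_density.sub (integrable_const _)
  have hb : ∀ i x, |partialDeriv i (conv W (density μ)) x| ≤
      K * ∫ y, |density μ y - (L ^ d)⁻¹| := fun i x => by
    rw [← conv_sub_const hW hWmean integrable_density ((L ^ d)⁻¹)]
    exact abs_partialDeriv_conv_le hW hK0 hK hi1 i x
  -- The test function is ρ^m itself, admissible because ρ^m ∈ H¹.
  have hE := sum_integral_sq_le hβ h2 hg.memLp_grad (fun i => (measurable_partialDeriv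
    (continuous_conv hW integrable_density) i).aestronglyMeasurable) hb (hweak _ _ hg)
  have hS := (integral_density_sq_sub_le hm hac h2 hg.memLp).trans
    ((poincare hg).trans (mul_le_mul_of_nonneg_left hE (sq_nonneg (L / (2 * Real.pi)))))
  have hN := integral_abs_density_sub_sq_le hac h2
  have hN2 := integral_abs_density_sub_le_two hac
  have hN0 : 0 ≤ ∫ x, |density μ x - (L ^ d)⁻¹| := integral_nonneg fun _ => abs_nonneg _
  have hVa : L ^ d * (L ^ d)⁻¹ = 1 := mul_inv_cancel₀ hV.ne'
  have ha : 0 < (L ^ d)⁻¹ := inv_pos.2 hV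
  clear hb hi1 hE
  generalize (∫ x, |density μ x - (L ^ d)⁻¹|) = N at *
  generalize (∫ x, density μ x ^ 2) = Q at *
  generalize ((L ^ d)⁻¹) ^ (m - 1) = p at *
  generalize (L ^ d)⁻¹ = a at *
  generalize L ^ d = V at *
  have hX : 0 ≤ Q - a := nonneg_of_mul_nonneg_right ((sq_nonneg N).trans hN) hV
  -- The constant is 5 = 4 + 1: split Q = (Q - a) + a, using N ≤ 2 on the first part and N² ≤ V(Q -
  -- a) with Va = 1 on the second.
  have hNQ : N ^ 2 * Q ≤ 5 * (Q - a) := by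
    have h3 : N ^ 2 * (Q - a) ≤ 4 * (Q - a) := mul_le_mul_of_nonneg_right (by nlinarith) hX
    have h4 := mul_le_mul_of_nonneg_right hN ha.le
    rw [mul_right_comm, hVa, one_mul] at h4
    linarith
  have e : (L / (2 * Real.pi)) ^ 2 * (β ^ 2 * (d * (K * N) ^ 2 * Q)) =
      β ^ 2 * ((L / (2 * Real.pi)) ^ 2 * (d * K ^ 2)) * (N ^ 2 * Q) := by ring
  have h4 := mul_le_mul_of_nonneg_left hNQ
    (show 0 ≤ β ^ 2 * ((L / (2 * Real.pi)) ^ 2 * (d * K ^ 2)) by positivity)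
  have hXz : Q - a ≤ 0 := by
    by_contra! hcon
    have := mul_lt_mul_of_pos_right hβK hcon
    linarith
  have hN3 : N ^ 2 ≤ 0 := hN.trans (mul_nonpos_of_nonneg_of_nonpos hV.le hXz)
  exact pow_eq_zero_iff two_ne_zero |>.1 (le_antisymm hN3 (sq_nonneg N))

end Stationary

end AggDiff

/-! ### Choice of the threshold δ. -/

theorem lemma5p6 (d : ℕ) (hd : 1 ≤ d) (L : ℝ) [Fact (0 < L)]
    (W : AggDiff.Torus d L → ℝ) (hW : AggDiff.IsCk 2 W)
    (hWeven : AggDiff.EvenInEachCoordinate W) (hWmean : ∫ x, W x = 0)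
    (m : ℝ) (hm : 1 < m) :
    ∃ δ : ℝ, 0 < δ ∧ ∀ β : ℝ, 0 < β → β < δ →
      (∀ μ : ProbabilityMeasure (AggDiff.Torus d L),
        AggDiff.IsStationarySolution β m W μ ↔ μ = AggDiff.flatState d L) ∧
      (∀ μ : ProbabilityMeasure (AggDiff.Torus d L),
        AggDiff.IsFreeEnergyMinimiser β m W μ ↔ μ = AggDiff.flatState d L) := by
  have hL : (0 : ℝ) < L := Fact.out
  have hc := hW.continuous
  obtain ⟨B, hB⟩ := AggDiff.exists_bound_of_continuous hc
  obtain ⟨K, hK0, hK⟩ := (hW.mono (m := 1) (by norm_num)).exists_lipschitz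
  have hB0 : 0 ≤ B := (abs_nonneg _).trans (hB 0)
  set p := ((L ^ d)⁻¹ : ℝ) ^ (m - 1)
  have hp : 0 < p := Real.rpow_pos_of_pos (by positivity) _
  set M := 5 * ((L / (2 * Real.pi)) ^ 2 * (d * K ^ 2))
  have hM : 0 ≤ M := by positivity
  -- The first bound serves the minimiser, the second the stationary states. Adding 1 keeps the
  -- denominators positive when B or M vanishes, and gives M ≤ (M + 1)².
  refine ⟨min (p / (2 * B + 1)) (p / (M + 1)), by positivity, fun β hβ hβδ => ⟨fun μ => ?_, ?_⟩⟩
  · refine ⟨fun h => h.eq_flatState hc hWmean hm hβ hK0 hK ?_, ?_⟩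
    · have h1 := hβδ.trans_le (min_le_right _ _)
      rw [lt_div_iff₀ (by positivity)] at h1
      change β ^ 2 * M < p ^ 2
      calc β ^ 2 * M ≤ (β * (M + 1)) ^ 2 := by
            rw [mul_pow]
            exact mul_le_mul_of_nonneg_left (by nlinarith) (sq_nonneg β)
        _ < p ^ 2 := pow_lt_pow_left₀ h1 (by positivity) two_ne_zero
    · rintro rfl
      exact AggDiff.isStationarySolution_flatState hWmean β m
  · have h1 := hβδ.trans_le (min_le_left _ _)
    rw [lt_div_iff₀ (by positivity)] at h1
    exact AggDiff.isFreeEnergyMinimiser_iff hc hB hWmean hm hβ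
      (by change β * (2 * B) < p; linarith)
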